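/- Conventions. Let $V$ be a real vector space of finite dimension $n$ with a nondegenerate symmetric bilinear form $h$ (of any signature), and let $A\in\otimes^4V^*$. Consider the identities $$A(x,y,z,w)+A(y,x,z,w)=0,\tag{a}$$ $$A(x,y,z,w)+A(y,z,x,w)+A(z,x,y,w)=0\quad\text{(the Bianchi identity)},\tag{b}$$ $$A(x,y,z,w)+A(x,y,w,z)=\tfrac2n\{\operatorname{Ric}(y,x)-\operatorname{Ric}(x,y)\}\,h(z,w),\tag{c}$$ $$A(x,y,z,w)+A(x,y,w,z)=0,\tag{d}$$ where $\operatorname{Ric}(x,y):=\operatorname{Tr}\{z\mapsto\mathcal A(z,x)y\}$ and $\mathcal A$ is given by $h(\mathcal A(x,y)z,w)=A(x,y,z,w)$. The tensor $A$ is a generalized curvature tensor if (a) and (b) hold, a Weyl generalized curvature tensor if (a), (b), (c) hold, and an algebraic curvature tensor if (a), (b), (d) hold. The conjugate tensor $A^*$ is defined by $A^*(x,y,w,z):=-A(x,y,z,w)$. A Weyl manifold $(N,g,\nabla)$ is a smooth $n$-dimensional manifold $N$ (without boundary) with a smooth pseudo-Riemannian metric $g$ and a smooth torsion free connection $\nabla$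 on $TN$ such that $\nabla g=-2\phi\otimes g$ for some smooth $1$-form $\phi$. Its curvature tensor is $R(x,y,z,w):=g((\nabla_x\nabla_y-\nabla_y\nabla_x-\nabla_{[x,y]})z,w)$, with conjugate curvature tensor $R^*(x,y,w,z):=-R(x,y,z,w)$. $H^1(N;\mathbb R)$ denotes the first de Rham cohomology group. Theorem. Assume $n\ge3$. (1) Let $A$ be a Weyl generalized curvature tensor on $(V,h)$. Then $A^*$ satisfies the Bianchi identity if and only if $A$ is an algebraic curvature tensor. (2) Let $(N,g,\nabla)$ be a Weyl manifold of dimension $n$ with $H^1(N;\mathbb R)=0$. Assume that the conjugate curvature tensor $R^*$ is, at every point of $N$, a generalized curvature tensor. Then there exists $f\in C^\infty(N)$ such that $\nabla$ is the Levi-Civita connection of the conformally equivalent metric $e^{2f}g$. -/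

import Mathlib

open scoped Manifold ContDiff Bundle

noncomputable section

/-! ### Symmetries of functions of four arguments

`V` is either a real vector space (with `K = ℝ`), or the space of smooth vector fields of a
manifold `N` (with `K` the functions on `N`).  In the second case an identity between tensor fields
is tested on smooth vector fields. -/

/-- `A(x,y,z,w) + A(y,x,z,w) = 0`. -/
def SkewInFirstPair {V K : Type*} [AddCommGroup K] (A : V → V → V → V → K) : Prop :=
  ∀ x y z w, A x y z w + A y x z w = 0

/-- The Bianchi identity `A(x,y,z,w) + A(y,z,x,w) + A(z,x,y,w) = 0`. -/
def BianchiIdentity {V K : Type*} [AddCommGroup K] (A : V → V → V → V → K) : Prop :=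
  ∀ x y z w, A x y z w + A y z x w + A z x y w = 0

/-- `A(x,y,z,w) + A(x,y,w,z) = 0`. -/
def SkewInLastPair {V K : Type*} [AddCommGroup K] (A : V → V → V → V → K) : Prop :=
  ∀ x y z w, A x y z w + A x y w z = 0

/-- The symmetries of a generalized curvature tensor. -/
def IsGeneralizedCurvature {V K : Type*} [AddCommGroup K] (A : V → V → V → V → K) : Prop :=
  SkewInFirstPair A ∧ BianchiIdentity A

/-- The symmetries of an algebraic curvature tensor. -/
def IsAlgebraicCurvature {V K : Type*} [AddCommGroup K] (A : V → V → V → V → K) : Prop :=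
  IsGeneralizedCurvature A ∧ SkewInLastPair A

/-- The conjugate `A*`, where `A*(x,y,w,z) = -A(x,y,z,w)`. -/
def conjugateCurvature {V K : Type*} [AddCommGroup K] (A : V → V → V → V → K) :
    V → V → V → V → K :=
  fun x y w z ↦ -A x y z w

/-! ### Algebra: 4-tensors on a finite dimensional real inner product space `(V, h)`

The inner product `h` is symmetric and nondegenerate, of any signature. -/

section Algebra

variable {V : Type*} [AddCommGroup V] [Module ℝ V] [FiniteDimensional ℝ V]

/-- The curvature operator `𝒜(x,y)` of a 4-tensor `A`, that is, the endomorphism of `V` with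
`h(𝒜(x,y)z, w) = A(x,y,z,w)`. -/
def algCurvatureOperator (h : LinearMap.BilinForm ℝ V) (hnd : h.Nondegenerate)
    (A : V →ₗ[ℝ] V →ₗ[ℝ] V →ₗ[ℝ] V →ₗ[ℝ] ℝ) :
    V →ₗ[ℝ] V →ₗ[ℝ] V →ₗ[ℝ] V :=
  A.compr₂ (LinearMap.compRight ℝ (M := V) (h.toDual hnd).symm.toLinearMap)

lemma algCurvatureOperator_spec (h : LinearMap.BilinForm ℝ V) (hnd : h.Nondegenerate)
    (A : V →ₗ[ℝ] V →ₗ[ℝ] V →ₗ[ℝ] V →ₗ[ℝ] ℝ) (x y z w : V) :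
    h (algCurvatureOperator h hnd A x y z) w = A x y z w := by
  simp [algCurvatureOperator]

/-- The Ricci tensor `Ric(x,y) = Tr{z ↦ 𝒜(z,x)y}`. -/
def algRicci (h : LinearMap.BilinForm ℝ V) (hnd : h.Nondegenerate)
    (A : V →ₗ[ℝ] V →ₗ[ℝ] V →ₗ[ℝ] V →ₗ[ℝ] ℝ) (x y : V) : ℝ :=
  LinearMap.trace ℝ V (((algCurvatureOperator h hnd A).flip x).flip y)

/-- `A` is a Weyl generalized curvature tensor: a generalized curvature tensor with
`A(x,y,z,w) + A(x,y,w,z) = (2/n) (Ric(y,x) - Ric(x,y)) h(z,w)`, `n = dim V`. -/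
def IsWeylCurvature (h : LinearMap.BilinForm ℝ V) (hnd : h.Nondegenerate)
    (A : V →ₗ[ℝ] V →ₗ[ℝ] V →ₗ[ℝ] V →ₗ[ℝ] ℝ) : Prop :=
  IsGeneralizedCurvature (A · · · ·) ∧
    ∀ x y z w, A x y z w + A x y w z =
      2 / (Module.finrank ℝ V : ℝ) * (algRicci h hnd A y x - algRicci h hnd A x y) * h z w

end Algebra

/-! ### Geometry: smooth manifolds without boundary of dimension `n` -/

section Geometry

variable (n : ℕ) (N : Type*) [TopologicalSpace N] [ChartedSpace (EuclideanSpace ℝ (Fin n)) N]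
  [IsManifold (𝓡 n) ∞ N]

/-- Smooth vector fields on `N`. -/
abbrev SmoothVectorField : Type _ :=
  ContMDiffSection (𝓡 n) (EuclideanSpace ℝ (Fin n)) ∞ (TangentSpace (𝓡 n) : N → Type _)

/-- Smooth `1`-forms on `N`: smooth sections of the cotangent bundle. -/
abbrev SmoothOneForm : Type _ :=
  ContMDiffSection (𝓡 n) (EuclideanSpace ℝ (Fin n) →L[ℝ] ℝ) ∞
    (fun p : N ↦ TangentSpace (𝓡 n) p →L[ℝ] Bundle.Trivial N ℝ p)

/-- A smooth pseudo-Riemannian metric on `N`. -/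
structure PseudoRiemannianMetric where
  /-- The scalar product on each tangent space. -/
  inner (p : N) : TangentSpace (𝓡 n) p →L[ℝ] TangentSpace (𝓡 n) p →L[ℝ] ℝ
  symm (p : N) (v w : TangentSpace (𝓡 n) p) : inner p v w = inner p w v
  nondegenerate (p : N) (v : TangentSpace (𝓡 n) p) (hv : ∀ w, inner p v w = 0) : v = 0
  contMDiff : ContMDiff (𝓡 n)
    ((𝓡 n).prod 𝓘(ℝ, EuclideanSpace ℝ (Fin n) →L[ℝ] EuclideanSpace ℝ (Fin n) →L[ℝ] ℝ)) ∞
    (fun p : N ↦ Bundle.TotalSpace.mk'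
      (EuclideanSpace ℝ (Fin n) →L[ℝ] EuclideanSpace ℝ (Fin n) →L[ℝ] ℝ) p (inner p))

/-- Connections (Koszul covariant derivatives) on the tangent bundle `TN`.  The derivative of the
vector field `Y` along `X` at `p` is `D Y p (X p)`. -/
abbrev Connection : Type _ :=
  CovariantDerivative (𝓡 n) (EuclideanSpace ℝ (Fin n)) (TangentSpace (𝓡 n) : N → Type _)

variable {n N}

/-- The conformally equivalent metric `e^{2f} g`. -/
def PseudoRiemannianMetric.conformal (g : PseudoRiemannianMetric n N) (f : N → ℝ)
    (hf : ContMDiff (𝓡 n) 𝓘(ℝ, ℝ) ∞ f) : PseudoRiemannianMetric n N where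
  inner p := Real.exp (2 * f p) • g.inner p
  symm p v w := by
    have := g.symm p v w
    simp [this]
  nondegenerate p v hv := by
    refine g.nondegenerate p v fun w ↦ ?_
    have := hv w
    simpa [Real.exp_ne_zero] using this
  contMDiff := by
    have he : ContMDiff (𝓡 n) 𝓘(ℝ, ℝ) ∞ (fun p : N ↦ Real.exp (2 * f p)) :=
      (Real.contDiff_exp.comp (contDiff_const.mul contDiff_id)).contMDiff.comp hf
    exact he.smul_section g.contMDiff

/-- `(∇_X g)(Y,Z) = X(g(Y,Z)) - g(∇_X Y, Z) - g(Y, ∇_X Z)` at `p`. -/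
def covDerivMetric (g : PseudoRiemannianMetric n N) (D : Connection n N)
    (X Y Z : SmoothVectorField n N) (p : N) : ℝ :=
  mvfderiv (𝓡 n) (fun q ↦ g.inner q (Y q) (Z q)) p (X p)
    - g.inner p (D Y p (X p)) (Z p) - g.inner p (Y p) (D Z p (X p))

/-- `(N, g, ∇)` is a Weyl manifold: `∇` is a smooth torsion free connection on `TN`, and
`∇g = -2 φ ⊗ g` for some smooth `1`-form `φ`. -/
def IsWeylManifold (g : PseudoRiemannianMetric n N) (D : Connection n N) : Prop :=
  CovariantDerivative.ContMDiffCovariantDerivative D ∞ ∧ D.torsion = 0 ∧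
    ∃ φ : SmoothOneForm n N, ∀ (X Y Z : SmoothVectorField n N) (p : N),
      covDerivMetric g D X Y Z p = -2 * φ p (X p) * g.inner p (Y p) (Z p)

/-- `∇` is the Levi-Civita connection of `g`: it is smooth, torsion free and `∇g = 0`. -/
def IsLeviCivita (g : PseudoRiemannianMetric n N) (D : Connection n N) : Prop :=
  CovariantDerivative.ContMDiffCovariantDerivative D ∞ ∧ D.torsion = 0 ∧
    ∀ (X Y Z : SmoothVectorField n N) (p : N), covDerivMetric g D X Y Z p = 0

/-- The curvature operator `ℛ(X,Y)Z = ∇_X ∇_Y Z - ∇_Y ∇_X Z - ∇_{[X,Y]} Z` at `p`. -/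
def curvatureOperator (D : Connection n N) (X Y Z : SmoothVectorField n N) (p : N) :
    TangentSpace (𝓡 n) p :=
  D (fun q ↦ D Z q (Y q)) p (X p) - D (fun q ↦ D Z q (X q)) p (Y p)
    - D Z p (VectorField.mlieBracket (𝓡 n) X Y p)

/-- The `g`-associated curvature tensor `R(X,Y,Z,W) = g(ℛ(X,Y)Z, W)`, evaluated on smooth vector
fields. -/
def curvatureTensor (g : PseudoRiemannianMetric n N) (D : Connection n N)
    (X Y Z W : SmoothVectorField n N) : N → ℝ :=
  fun p ↦ g.inner p (curvatureOperator D X Y Z p) (W p)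

/-! ### The first de Rham cohomology -/

/-- `dφ(X,Y) = X(φ(Y)) - Y(φ(X)) - φ([X,Y])` at `p`. -/
def oneFormDeriv (φ : SmoothOneForm n N) (X Y : SmoothVectorField n N) (p : N) : ℝ :=
  mvfderiv (𝓡 n) (fun q ↦ (φ q (Y q) : ℝ)) p (X p)
    - mvfderiv (𝓡 n) (fun q ↦ (φ q (X q) : ℝ)) p (Y p)
    - φ p (VectorField.mlieBracket (𝓡 n) X Y p)

lemma SmoothOneForm.mdifferentiableAt_apply (φ : SmoothOneForm n N) (X : SmoothVectorField n N)
    (p : N) : MDifferentiableAt (𝓡 n) 𝓘(ℝ, ℝ) (fun q ↦ (φ q (X q) : ℝ)) p := by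
  have h : ContMDiff (𝓡 n) ((𝓡 n).prod 𝓘(ℝ, ℝ)) ∞
      (fun q : N ↦ Bundle.TotalSpace.mk' ℝ (E := Bundle.Trivial N ℝ) q (φ q (X q))) :=
    ContMDiff.clm_bundle_apply φ.contMDiff X.contMDiff
  have h' := (h p).mdifferentiableAt (by simp)
  rw [mdifferentiableAt_totalSpace] at h'
  exact h'.2

lemma oneFormDeriv_add (φ ψ : SmoothOneForm n N) (X Y : SmoothVectorField n N) (p : N) :
    oneFormDeriv (φ + ψ) X Y p = oneFormDeriv φ X Y p + oneFormDeriv ψ X Y p := by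
  have key (Z : SmoothVectorField n N) :
      mvfderiv (𝓡 n) (fun q ↦ ((φ + ψ) q (Z q) : ℝ)) p =
        mvfderiv (𝓡 n) (fun q ↦ (φ q (Z q) : ℝ)) p
          + mvfderiv (𝓡 n) (fun q ↦ (ψ q (Z q) : ℝ)) p :=
    mvfderiv_add (φ.mdifferentiableAt_apply Z p) (ψ.mdifferentiableAt_apply Z p)
  have hb : ((φ + ψ) p (VectorField.mlieBracket (𝓡 n) X Y p) : ℝ) =
      φ p (VectorField.mlieBracket (𝓡 n) X Y p) + ψ p (VectorField.mlieBracket (𝓡 n) X Y p) := rfl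
  simp only [oneFormDeriv, key, hb, add_apply]
  ring

lemma oneFormDeriv_smul (c : ℝ) (φ : SmoothOneForm n N) (X Y : SmoothVectorField n N) (p : N) :
    oneFormDeriv (c • φ) X Y p = c * oneFormDeriv φ X Y p := by
  have key (Z : SmoothVectorField n N) :
      mvfderiv (𝓡 n) (fun q ↦ ((c • φ) q (Z q) : ℝ)) p =
        c • mvfderiv (𝓡 n) (fun q ↦ (φ q (Z q) : ℝ)) p := by
    have h := mvfderiv_smul (I := 𝓡 n) (x := p) (a := fun _ : N ↦ c) mdifferentiableAt_const
      (φ.mdifferentiableAt_apply Z p)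
    rw [mvfderiv_const] at h
    ext v
    have h' := congrArg (fun L ↦ L v) h
    refine Eq.trans h' ?_
    simp
  have hb : ((c • φ) p (VectorField.mlieBracket (𝓡 n) X Y p) : ℝ) =
      c * φ p (VectorField.mlieBracket (𝓡 n) X Y p) := rfl
  simp only [oneFormDeriv, key, hb, smul_apply, smul_eq_mul]
  ring

variable (n N)

/-- Closed smooth `1`-forms. -/
def closedOneForms : Submodule ℝ (SmoothOneForm n N) where
  carrier := {φ | ∀ (X Y : SmoothVectorField n N) (p : N), oneFormDeriv φ X Y p = 0}
  zero_mem' X Y p := by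
    have h := oneFormDeriv_add (0 : SmoothOneForm n N) 0 X Y p
    have h0 : (0 : SmoothOneForm n N) + 0 = 0 := add_zero _
    rw [h0] at h
    linarith
  add_mem' hφ hψ X Y p := by rw [oneFormDeriv_add, hφ X Y p, hψ X Y p, add_zero]
  smul_mem' c φ hφ X Y p := by rw [oneFormDeriv_smul, hφ X Y p, mul_zero]

/-- Exact smooth `1`-forms: the differentials `df` of smooth functions `f`. -/
def exactOneForms : Submodule ℝ (SmoothOneForm n N) where
  carrier := {φ | ∃ f : N → ℝ, ContMDiff (𝓡 n) 𝓘(ℝ, ℝ) ∞ f ∧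
    ∀ (p : N) (v : TangentSpace (𝓡 n) p), φ p v = mvfderiv (𝓡 n) f p v}
  zero_mem' := by
    refine ⟨0, contMDiff_const, fun p v ↦ ?_⟩
    rw [mvfderiv_zero]; rfl
  add_mem' := by
    rintro φ ψ ⟨f, hf, hφ⟩ ⟨k, hk, hψ⟩
    refine ⟨f + k, hf.add hk, fun p v ↦ ?_⟩
    rw [mvfderiv_add ((hf p).mdifferentiableAt (by simp)) ((hk p).mdifferentiableAt (by simp)),
      add_apply, ← hφ, ← hψ]
    rfl
  smul_mem' := by
    rintro c φ ⟨f, hf, hφ⟩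
    refine ⟨fun p ↦ c * f p, contMDiff_const.mul hf, fun p v ↦ ?_⟩
    have h := mvfderiv_smul (I := 𝓡 n) (x := p) (a := fun _ : N ↦ c) mdifferentiableAt_const
      ((hf p).mdifferentiableAt (by simp))
    rw [mvfderiv_const] at h
    have h' := congrArg (fun L ↦ L v) h
    have h1 : (c • φ) p v = c * φ p v := rfl
    rw [h1, hφ]
    refine Eq.trans ?_ h'.symm
    simp

/-- The first de Rham cohomology `H¹(N; ℝ)`: closed `1`-forms modulo exact `1`-forms. -/
abbrev DeRhamH1 : Type _ :=
  closedOneForms n N ⧸ (exactOneForms n N).submoduleOf (closedOneForms n N)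

end Geometry

end

/-!
Write `θ(x,y) = (2/n)(Ric(y,x) - Ric(x,y))`, so that a Weyl curvature tensor satisfies
`A(x,y,z,w) + A(x,y,w,z) = θ(x,y) h(z,w)`. Adding the cyclic sums in `x, y, z` of
`A(x,y,z,w)` and of `A(x,y,w,z)`, which vanish by the Bianchi identities of `A` and of `A*`, gives
`θ(x,y) z + θ(y,z) x + θ(z,x) y = 0`, because `h` is nondegenerate. In dimension at least three `z`
can be taken independent of `x` and `y`, so `θ = 0`
(`exists_forall_smul_add_smul_add_smul_eq_zero`). Conversely `A* = A` for an algebraic curvature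
tensor.

On a Weyl manifold the role of `θ` is played by `2 dφ`: differentiating `∇g = -2 φ ⊗ g` once more
and antisymmetrizing gives `R(X,Y,Z,W) + R(X,Y,W,Z) = 2 dφ(X,Y) g(Z,W)`
(`curvatureTensor_add_swap`), and `R` satisfies the Bianchi identity because `∇` is torsion free
(`curvatureOperator_bianchi`). The linear algebra above, applied in each tangent space, shows that
`φ` is closed (`oneFormDeriv_eq_zero`), hence exact, `φ = df`, as `H¹(N; ℝ) = 0`. Then
`∇(e^{2f} g) = 2 df ⊗ e^{2f} g - 2 φ ⊗ e^{2f} g = 0` (`isLeviCivita_conformal`).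

Tensor identities are tested on smooth vector fields, so the pointwise arguments use that every
tangent vector extends to one (`SmoothVectorField.exists_apply_eq`).
-/

/-! ### Linear algebra -/

/-- In dimension at least three a third vector can be chosen off the plane of the first two, so
the `z`-coefficient of a linear relation between `x`, `y`, `z` vanishes. -/
lemma exists_forall_smul_add_smul_add_smul_eq_zero {V : Type*} [AddCommGroup V] [Module ℝ V]
    [FiniteDimensional ℝ V] (hV : 3 ≤ Module.finrank ℝ V) (x y : V) :
    ∃ z : V, ∀ a b c : ℝ, a • z + b • x + c • y = 0 → a = 0 := by
  have hlt : Submodule.span ℝ {x, y} < ⊤ := by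
    refine Submodule.lt_top_of_finrank_lt_finrank (lt_of_le_of_lt ?_ (show 2 < _ from hV))
    classical
    have h := finrank_span_finset_le_card (R := ℝ) ({x, y} : Finset V)
    rw [Finset.coe_pair] at h
    exact h.trans Finset.card_le_two
  obtain ⟨z, -, hz⟩ := SetLike.exists_of_lt hlt
  refine ⟨z, fun a b c h ↦ by_contra fun ha ↦ hz ?_⟩
  rw [Submodule.mem_span_pair]
  refine ⟨-(a⁻¹ * b), -(a⁻¹ * c), ?_⟩
  have hz' : a⁻¹ • (a • z + b • x + c • y) = 0 := by rw [h, smul_zero]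
  rw [smul_add, smul_add, inv_smul_smul₀ ha, smul_smul, smul_smul] at hz'
  rw [← sub_eq_zero, ← neg_eq_zero, ← hz']
  module

theorem IsWeylCurvature.bianchiIdentity_conjugate_iff {V : Type*} [AddCommGroup V] [Module ℝ V]
    [FiniteDimensional ℝ V] (hV : 3 ≤ Module.finrank ℝ V) {h : LinearMap.BilinForm ℝ V}
    {hnd : h.Nondegenerate} {A : V →ₗ[ℝ] V →ₗ[ℝ] V →ₗ[ℝ] V →ₗ[ℝ] ℝ}
    (hA : IsWeylCurvature h hnd A) :
    BianchiIdentity (conjugateCurvature (A · · · ·)) ↔ IsAlgebraicCurvature (A · · · ·) := by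
  obtain ⟨hgen, hweyl⟩ := hA
  constructor
  · intro hB
    refine ⟨hgen, fun x y z w ↦ ?_⟩
    set θ : V → V → ℝ := fun x y ↦
      2 / (Module.finrank ℝ V : ℝ) * (algRicci h hnd A y x - algRicci h hnd A x y)
    have hc (x y z w : V) : A x y z w + A x y w z = θ x y * h z w := hweyl x y z w
    have key (x y z : V) : θ x y • z + θ y z • x + θ z x • y = 0 := by
      refine hnd.1 _ fun w ↦ ?_
      have h1 : A x y z w + A y z x w + A z x y w = 0 := hgen.2 x y z w
      have h2 : -A x y w z + -A y z w x + -A z x w y = 0 := hB x y z w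
      simp only [map_add, map_smul, LinearMap.add_apply, LinearMap.smul_apply, smul_eq_mul]
      linarith [hc x y z w, hc y z x w, hc z x y w]
    obtain ⟨u, hu⟩ := exists_forall_smul_add_smul_add_smul_eq_zero hV x y
    have := hc x y z w
    rwa [hu _ _ _ (key x y u), zero_mul] at this
  · intro hA x y z w
    have h1 : A x y z w + A y z x w + A z x y w = 0 := hA.1.2 x y z w
    have hd (x y z w : V) : A x y z w + A x y w z = 0 := hA.2 x y z w
    change -A x y w z + -A y z w x + -A z x w y = 0
    linarith [hd x y z w, hd y z x w, hd z x y w]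

/-! ### Smooth vector fields -/

section VectorFields

variable {n : ℕ} {N : Type*} [TopologicalSpace N] [ChartedSpace (EuclideanSpace ℝ (Fin n)) N]
  [IsManifold (𝓡 n) ∞ N]

variable (n N) in
lemma isManifold_minSmoothness (k : ℕ) : IsManifold (𝓡 n) (minSmoothness ℝ k) N := by
  rw [minSmoothness_of_isRCLikeNormedField]
  exact IsManifold.of_le (n := ∞) (mod_cast le_top)

namespace SmoothVectorField

lemma mdifferentiableAt (X : SmoothVectorField n N) (p : N) :
    MDifferentiableAt (𝓡 n) ((𝓡 n).prod 𝓘(ℝ, EuclideanSpace ℝ (Fin n)))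
      (fun q ↦ (X q : TangentBundle (𝓡 n) N)) p :=
  (X.contMDiff p).mdifferentiableAt (by simp)

/-- Every tangent vector is the value of a smooth vector field: cut off a local extension by a
bump function. -/
lemma exists_apply_eq [T2Space N] (p : N) (v : TangentSpace (𝓡 n) p) :
    ∃ X : SmoothVectorField n N, X p = v := by
  obtain ⟨s, hs, hext⟩ := FiberBundle.exists_contMDiffOn_extend (k := ∞) (𝓡 n)
    (EuclideanSpace ℝ (Fin n)) v
  obtain ⟨f, -, hf⟩ := (SmoothBumpFunction.nhds_basis_tsupport (I := 𝓡 n) p).mem_iff.1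
    (interior_mem_nhds.2 hs)
  refine ⟨⟨_, ContMDiffOn.smul_section_of_tsupport f.contMDiff.contMDiffOn isOpen_interior hf
    (hext.mono interior_subset)⟩, ?_⟩
  change f p • FiberBundle.extend (EuclideanSpace ℝ (Fin n)) v p = v
  simp

/-- The Lie bracket `[X, Y]`, as a smooth vector field. -/
noncomputable def bracket (X Y : SmoothVectorField n N) : SmoothVectorField n N :=
  have : IsManifold (𝓡 n) (minSmoothness ℝ 2) N := isManifold_minSmoothness n N 2
  have : IsManifold (𝓡 n) ((⊤ : ℕ∞) + 1) N := IsManifold.of_le (n := ∞) (by simp)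
  ⟨VectorField.mlieBracket (𝓡 n) X Y,
    ContDiff.mlieBracket_vectorField (m := ⊤) (n := ⊤) X.contMDiff Y.contMDiff (by simp)⟩

@[simp]
lemma bracket_apply (X Y : SmoothVectorField n N) (p : N) :
    X.bracket Y p = VectorField.mlieBracket (𝓡 n) X Y p := rfl

lemma jacobi (X Y Z : SmoothVectorField n N) :
    X.bracket (Y.bracket Z) = (X.bracket Y).bracket Z + Y.bracket (X.bracket Z) := by
  have : IsManifold (𝓡 n) (minSmoothness ℝ 3) N := isManifold_minSmoothness n N 3
  have h2 : minSmoothness ℝ 2 ≤ ∞ := by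
    rw [minSmoothness_of_isRCLikeNormedField]
    exact ENat.LEInfty.out
  ext p
  exact VectorField.leibniz_identity_mlieBracket_apply (X.contMDiff.of_le h2 p)
    (Y.contMDiff.of_le h2 p) (Z.contMDiff.of_le h2 p)

/-- The covariant derivative `∇_X Y` along a smooth connection `∇`, as a smooth vector field. -/
noncomputable def cov (D : Connection n N)
    (hD : CovariantDerivative.ContMDiffCovariantDerivative D ∞)
    (X Y : SmoothVectorField n N) : SmoothVectorField n N :=
  ⟨fun p ↦ D Y p (X p), ContMDiff.clm_bundle_apply
    (contMDiffOn_univ.1 (hD.contMDiff.contMDiff Y.contMDiff.contMDiffOn)) X.contMDiff⟩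

@[simp]
lemma cov_apply (D : Connection n N) (hD : CovariantDerivative.ContMDiffCovariantDerivative D ∞)
    (X Y : SmoothVectorField n N) (p : N) : cov D hD X Y p = D Y p (X p) := rfl

end SmoothVectorField

/-- The commutator of vector fields, acting on functions, is their Lie bracket.  This follows by
expanding the Jacobi identity for `X`, `Y` and `u Z` with the Leibniz rule: what is left is the
claim, times `Z`. -/
lemma mvfderiv_mlieBracket [T2Space N] {u : N → ℝ} (hu : ContMDiff (𝓡 n) 𝓘(ℝ, ℝ) ∞ u)
    (X Y : SmoothVectorField n N) {p : N}
    (hX : MDifferentiableAt (𝓡 n) 𝓘(ℝ, ℝ) (fun q ↦ mvfderiv (𝓡 n) u q (X q)) p)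
    (hY : MDifferentiableAt (𝓡 n) 𝓘(ℝ, ℝ) (fun q ↦ mvfderiv (𝓡 n) u q (Y q)) p) :
    mvfderiv (𝓡 n) u p (VectorField.mlieBracket (𝓡 n) X Y p) =
      mvfderiv (𝓡 n) (fun q ↦ mvfderiv (𝓡 n) u q (Y q)) p (X p) -
        mvfderiv (𝓡 n) (fun q ↦ mvfderiv (𝓡 n) u q (X q)) p (Y p) := by
  -- In dimension zero there is no nonzero `Z`, but there all terms vanish.
  rcases subsingleton_or_nontrivial (TangentSpace (𝓡 n) p) with hs | hs
  · rw [Subsingleton.elim (VectorField.mlieBracket (𝓡 n) X Y p) 0, Subsingleton.elim (X p) 0,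
      Subsingleton.elim (Y p) 0]
    simp
  obtain ⟨v, hv⟩ := exists_ne (0 : TangentSpace (𝓡 n) p)
  obtain ⟨Z, rfl⟩ := SmoothVectorField.exists_apply_eq p v
  have hum (q : N) : MDifferentiableAt (𝓡 n) 𝓘(ℝ, ℝ) u q := (hu q).mdifferentiableAt (by simp)
  let uZ : SmoothVectorField n N := ⟨u • (Z : ∀ q : N, TangentSpace (𝓡 n) q),
    hu.smul_section Z.contMDiff⟩
  have huZ : (uZ : ∀ q : N, TangentSpace (𝓡 n) q) = u • (Z : ∀ q : N, TangentSpace (𝓡 n) q) := rfl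
  have hmu {V : SmoothVectorField n N} :
      MDifferentiableAt (𝓡 n) ((𝓡 n).prod 𝓘(ℝ, EuclideanSpace ℝ (Fin n)))
        (fun q ↦ ((u • (V : ∀ q : N, TangentSpace (𝓡 n) q)) q : TangentBundle (𝓡 n) N)) p :=
    ((hu.smul_section V.contMDiff) p).mdifferentiableAt (by simp)
  have := isManifold_minSmoothness n N 2
  -- `[V, u Z] = (V u) Z + u [V, Z]`, and then the same rule applied twice.
  have hb (V : SmoothVectorField n N) : VectorField.mlieBracket (𝓡 n) V uZ =
      (fun q ↦ mvfderiv (𝓡 n) u q (V q)) • (Z : ∀ q : N, TangentSpace (𝓡 n) q) +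
        u • (V.bracket Z : ∀ q : N, TangentSpace (𝓡 n) q) := by
    funext q
    rw [huZ, VectorField.mlieBracket_smul_right (hum q) (Z.mdifferentiableAt q)]
    rfl
  have hbb (V W : SmoothVectorField n N)
      (hW : MDifferentiableAt (𝓡 n) 𝓘(ℝ, ℝ) (fun q ↦ mvfderiv (𝓡 n) u q (W q)) p) :
      V.bracket (W.bracket uZ) p =
        mvfderiv (𝓡 n) (fun q ↦ mvfderiv (𝓡 n) u q (W q)) p (V p) • Z p +
          mvfderiv (𝓡 n) u p (W p) • V.bracket Z p + (mvfderiv (𝓡 n) u p (V p) • W.bracket Z p +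
          u p • V.bracket (W.bracket Z) p) := by
    have h : V.bracket (W.bracket uZ) p =
      VectorField.mlieBracket (𝓡 n) V (VectorField.mlieBracket (𝓡 n) W uZ) p := rfl
    rw [h, hb, VectorField.mlieBracket_add_right (hW.smul_section
      (Z.mdifferentiableAt p)) hmu, VectorField.mlieBracket_smul_right hW (Z.mdifferentiableAt p),
      VectorField.mlieBracket_smul_right (hum p) ((W.bracket Z).mdifferentiableAt p)]
    rfl
  have hJ := congrArg (fun V : SmoothVectorField n N ↦ V p) (SmoothVectorField.jacobi X Y uZ)
  have hJZ := congrArg (fun V : SmoothVectorField n N ↦ V p) (SmoothVectorField.jacobi X Y Z)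
  have hl : (X.bracket Y).bracket uZ p = _ := congrFun (hb (X.bracket Y)) p
  simp only [ContMDiffSection.coe_add, Pi.add_apply] at hJ hJZ hl
  rw [hbb X Y hY, hbb Y X hX, hl, hJZ] at hJ
  have key : (mvfderiv (𝓡 n) u p (X.bracket Y p) -
      (mvfderiv (𝓡 n) (fun q ↦ mvfderiv (𝓡 n) u q (Y q)) p (X p) -
        mvfderiv (𝓡 n) (fun q ↦ mvfderiv (𝓡 n) u q (X q)) p (Y p))) • Z p = 0 := by
    simp only [Pi.smul_apply'] at hJ
    rw [← sub_eq_zero, ← neg_eq_zero] at hJ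
    rw [← hJ]
    module
  exact sub_eq_zero.1 ((smul_eq_zero.1 key).resolve_right hv)

end VectorFields

/-! ### Curvature of Weyl manifolds -/

section Weyl

variable {n : ℕ} {N : Type*} [TopologicalSpace N] [ChartedSpace (EuclideanSpace ℝ (Fin n)) N]
  [IsManifold (𝓡 n) ∞ N]

lemma PseudoRiemannianMetric.contMDiff_inner (g : PseudoRiemannianMetric n N)
    (X Y : SmoothVectorField n N) :
    ContMDiff (𝓡 n) 𝓘(ℝ, ℝ) ∞ (fun q ↦ g.inner q (X q) (Y q)) := by
  have h : ContMDiff (𝓡 n) ((𝓡 n).prod 𝓘(ℝ, ℝ)) ∞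
      (fun q : N ↦ Bundle.TotalSpace.mk' ℝ (E := Bundle.Trivial N ℝ) q
        (g.inner q (X q) (Y q))) :=
    ContMDiff.clm_bundle_apply₂ (F₁ := EuclideanSpace ℝ (Fin n))
      (F₂ := EuclideanSpace ℝ (Fin n)) g.contMDiff X.contMDiff Y.contMDiff
  exact fun p ↦ (Bundle.contMDiffAt_section p).1 (h p)

lemma PseudoRiemannianMetric.mdifferentiableAt_inner (g : PseudoRiemannianMetric n N)
    (X Y : SmoothVectorField n N) (p : N) :
    MDifferentiableAt (𝓡 n) 𝓘(ℝ, ℝ) (fun q ↦ g.inner q (X q) (Y q)) p :=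
  (g.contMDiff_inner X Y p).mdifferentiableAt (by simp)

open SmoothVectorField

lemma curvatureOperator_eq_cov {D : Connection n N}
    (hD : CovariantDerivative.ContMDiffCovariantDerivative D ∞)
    (X Y Z : SmoothVectorField n N) (p : N) :
    curvatureOperator D X Y Z p =
      cov D hD X (cov D hD Y Z) p - cov D hD Y (cov D hD X Z) p - cov D hD (X.bracket Y) Z p := rfl

lemma SmoothVectorField.cov_sub {D : Connection n N}
    (hD : CovariantDerivative.ContMDiffCovariantDerivative D ∞)
    (X Y Z : SmoothVectorField n N) :
    cov D hD X (Y - Z) = cov D hD X Y - cov D hD X Z := by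
  rw [eq_sub_iff_add_eq]
  ext p
  have h := D.isCovariantDerivativeOnUniv.add ((Y - Z).mdifferentiableAt p) (Z.mdifferentiableAt p)
  have h' := congrArg (fun L ↦ L (X p)) h
  rw [← ContMDiffSection.coe_add, sub_add_cancel] at h'
  exact h'.symm

lemma SmoothVectorField.cov_sub_cov {D : Connection n N}
    (hD : CovariantDerivative.ContMDiffCovariantDerivative D ∞)
    (hT : D.torsion = 0) (X Y : SmoothVectorField n N) :
    cov D hD X Y - cov D hD Y X = X.bracket Y := by
  ext p
  exact D.torsion_eq_zero_iff.1 hT (X.mdifferentiableAt p) (Y.mdifferentiableAt p)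

/-- The first Bianchi identity of a torsion free connection: grouping the second derivatives by the
outer vector field turns the cyclic sum into the Jacobi identity. -/
lemma curvatureOperator_bianchi {D : Connection n N}
    (hD : CovariantDerivative.ContMDiffCovariantDerivative D ∞)
    (hT : D.torsion = 0) (X Y Z : SmoothVectorField n N) (p : N) :
    curvatureOperator D X Y Z p + curvatureOperator D Y Z X p + curvatureOperator D Z X Y p = 0 := by
  have h (X Y Z : SmoothVectorField n N) : cov D hD X (cov D hD Y Z) p -
      cov D hD X (cov D hD Z Y) p - cov D hD (Y.bracket Z) X p = X.bracket (Y.bracket Z) p := by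
    rw [← cov_sub_cov hD hT X (Y.bracket Z), ← cov_sub_cov hD hT Y Z, cov_sub]
    rfl
  have hJ := congrArg (fun V : SmoothVectorField n N ↦ V p) (SmoothVectorField.jacobi X Y Z)
  have h1 : (X.bracket Y).bracket Z p = -Z.bracket (X.bracket Y) p :=
    VectorField.mlieBracket_swap_apply
  have h2 : cov D hD (Z.bracket X) Y p = -cov D hD (X.bracket Z) Y p := by
    rw [cov_apply, cov_apply, bracket_apply, VectorField.mlieBracket_swap_apply, map_neg]
    rfl
  simp only [ContMDiffSection.coe_add, Pi.add_apply] at hJ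
  rw [h1, ← h X Y Z, ← h Y X Z, ← h Z X Y] at hJ
  simp only [curvatureOperator_eq_cov hD, h2]
  rw [← sub_eq_zero] at hJ
  rw [← hJ]
  abel

/-- The symmetric part of the curvature of a Weyl connection: differentiate the function `g(Z,W)`
along `X` and `Y` by the product rule for `∇g = -2 φ ⊗ g`, and compare the commutator with the
derivative along `[X,Y]`. -/
lemma curvatureTensor_add_swap [T2Space N] {g : PseudoRiemannianMetric n N} {D : Connection n N}
    (hD : CovariantDerivative.ContMDiffCovariantDerivative D ∞) {φ : SmoothOneForm n N}
    (hφ : ∀ (X Y Z : SmoothVectorField n N) (p : N),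
      covDerivMetric g D X Y Z p = -2 * φ p (X p) * g.inner p (Y p) (Z p))
    (X Y Z W : SmoothVectorField n N) (p : N) :
    curvatureTensor g D X Y Z W p + curvatureTensor g D X Y W Z p =
      2 * oneFormDeriv φ X Y p * g.inner p (Z p) (W p) := by
  -- `X(g(Y,Z)) = g(∇_X Y, Z) + g(Y, ∇_X Z) - 2 φ(X) g(Y,Z)`.
  have hd (X Y Z : SmoothVectorField n N) (p : N) :
      mvfderiv (𝓡 n) (fun q ↦ g.inner q (Y q) (Z q)) p (X p) =
        g.inner p (cov D hD X Y p) (Z p) + g.inner p (Y p) (cov D hD X Z p) +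
          (-2 * φ p (X p)) * g.inner p (Y p) (Z p) := by
    have := hφ X Y Z p
    simp only [covDerivMetric] at this
    simp only [cov_apply]
    linarith
  have hf (Y : SmoothVectorField n N) :
      (fun q ↦ mvfderiv (𝓡 n) (fun q ↦ g.inner q (Z q) (W q)) q (Y q)) =
        fun q ↦ g.inner q (cov D hD Y Z q) (W q) + g.inner q (Z q) (cov D hD Y W q) +
          (-2 * φ q (Y q)) * g.inner q (Z q) (W q) := funext fun q ↦ hd Y Z W q
  have hφd (Y : SmoothVectorField n N) : MDifferentiableAt (𝓡 n) 𝓘(ℝ, ℝ)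
      (fun q ↦ (-2 * φ q (Y q) : ℝ)) p :=
    MDifferentiableAt.mul mdifferentiableAt_const (φ.mdifferentiableAt_apply Y p)
  have hdiff (Y : SmoothVectorField n N) : MDifferentiableAt (𝓡 n) 𝓘(ℝ, ℝ)
      (fun q ↦ mvfderiv (𝓡 n) (fun q ↦ g.inner q (Z q) (W q)) q (Y q)) p := by
    rw [hf]
    exact ((g.mdifferentiableAt_inner _ _ p).add (g.mdifferentiableAt_inner _ _ p)).add
      ((hφd Y).mul (g.mdifferentiableAt_inner _ _ p))
  have hdd (X Y : SmoothVectorField n N) :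
      mvfderiv (𝓡 n)
          (fun q ↦ mvfderiv (𝓡 n) (fun q ↦ g.inner q (Z q) (W q)) q (Y q)) p (X p) =
        mvfderiv (𝓡 n) (fun q ↦ g.inner q (cov D hD Y Z q) (W q)) p (X p) +
          mvfderiv (𝓡 n) (fun q ↦ g.inner q (Z q) (cov D hD Y W q)) p (X p) +
          (-2 * φ p (Y p) * mvfderiv (𝓡 n) (fun q ↦ g.inner q (Z q) (W q)) p (X p) +
            g.inner p (Z p) (W p) *
              (-2 * mvfderiv (𝓡 n) (fun q ↦ (φ q (Y q) : ℝ)) p (X p))) := by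
    have hadd : MDifferentiableAt (𝓡 n) 𝓘(ℝ, ℝ) (fun q ↦
        g.inner q (cov D hD Y Z q) (W q) + g.inner q (Z q) (cov D hD Y W q)) p :=
      (g.mdifferentiableAt_inner _ _ p).add (g.mdifferentiableAt_inner _ _ p)
    have hmul : MDifferentiableAt (𝓡 n) 𝓘(ℝ, ℝ) (fun q ↦
        (-2 * φ q (Y q)) * g.inner q (Z q) (W q)) p :=
      (hφd Y).mul (g.mdifferentiableAt_inner _ _ p)
    rw [hf, mvfderiv_fun_add hadd hmul,
      mvfderiv_fun_add (g.mdifferentiableAt_inner _ _ p) (g.mdifferentiableAt_inner _ _ p),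
      mvfderiv_fun_mul (hφd Y) (g.mdifferentiableAt_inner _ _ p),
      mvfderiv_fun_mul mdifferentiableAt_const (φ.mdifferentiableAt_apply Y p), mvfderiv_const]
    simp
  have hcomm := mvfderiv_mlieBracket (g.contMDiff_inner Z W) X Y (hdiff X) (hdiff Y)
  rw [hdd X Y, hdd Y X] at hcomm
  have hb := hd (X.bracket Y) Z W p
  rw [bracket_apply, hcomm] at hb
  simp only [hd] at hb
  simp only [curvatureTensor, curvatureOperator_eq_cov hD, oneFormDeriv, map_sub,
    sub_apply]
  rw [g.symm p (cov D hD X (cov D hD Y W) p), g.symm p (cov D hD Y (cov D hD X W) p),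
    g.symm p (cov D hD (X.bracket Y) W p)]
  linear_combination hb

/-- The Bianchi identities of `R` and `R*` force `dφ(X,Y) Z + dφ(Y,Z) X + dφ(Z,X) Y = 0`, so `φ` is
closed in dimension at least three. -/
lemma oneFormDeriv_eq_zero [T2Space N] (hn : 3 ≤ n) {g : PseudoRiemannianMetric n N}
    {D : Connection n N} (hD : CovariantDerivative.ContMDiffCovariantDerivative D ∞)
    (hT : D.torsion = 0) {φ : SmoothOneForm n N}
    (hφ : ∀ (X Y Z : SmoothVectorField n N) (p : N),
      covDerivMetric g D X Y Z p = -2 * φ p (X p) * g.inner p (Y p) (Z p))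
    (hB : BianchiIdentity (conjugateCurvature (curvatureTensor g D)))
    (X Y : SmoothVectorField n N) (p : N) : oneFormDeriv φ X Y p = 0 := by
  have key (Z : SmoothVectorField n N) : oneFormDeriv φ X Y p • Z p +
      oneFormDeriv φ Y Z p • X p + oneFormDeriv φ Z X p • Y p = 0 := by
    refine g.nondegenerate p _ fun w ↦ ?_
    obtain ⟨W, rfl⟩ := SmoothVectorField.exists_apply_eq p w
    have h1 := congrFun (hB X Y Z W) p
    have h2 := congrArg (fun v ↦ g.inner p v (W p)) (curvatureOperator_bianchi hD hT X Y Z p)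
    simp only [map_add, map_smul, map_zero, add_apply, smul_apply, zero_apply, smul_eq_mul,
      conjugateCurvature, Pi.add_apply, Pi.neg_apply, Pi.zero_apply] at h1 h2 ⊢
    have h3 := curvatureTensor_add_swap hD hφ X Y Z W p
    have h4 := curvatureTensor_add_swap hD hφ Y Z X W p
    have h5 := curvatureTensor_add_swap hD hφ Z X Y W p
    simp only [curvatureTensor] at h1 h3 h4 h5
    linarith
  have hrank : Module.finrank ℝ (TangentSpace (𝓡 n) p) = n := finrank_euclideanSpace_fin
  have : FiniteDimensional ℝ (TangentSpace (𝓡 n) p) :=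
    inferInstanceAs (FiniteDimensional ℝ (EuclideanSpace ℝ (Fin n)))
  obtain ⟨z, hz⟩ :=
    exists_forall_smul_add_smul_add_smul_eq_zero (hn.trans_eq hrank.symm) (X p) (Y p)
  obtain ⟨Z, rfl⟩ := SmoothVectorField.exists_apply_eq p z
  exact hz _ _ _ (key Z)

lemma isLeviCivita_conformal {g : PseudoRiemannianMetric n N} {D : Connection n N}
    (hD : CovariantDerivative.ContMDiffCovariantDerivative D ∞) (hT : D.torsion = 0) {f : N → ℝ}
    (hf : ContMDiff (𝓡 n) 𝓘(ℝ, ℝ) ∞ f)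
    (hg : ∀ (X Y Z : SmoothVectorField n N) (p : N),
      covDerivMetric g D X Y Z p = -2 * mvfderiv (𝓡 n) f p (X p) * g.inner p (Y p) (Z p)) :
    IsLeviCivita (g.conformal f hf) D := by
  refine ⟨hD, hT, fun X Y Z p ↦ ?_⟩
  have h := hg X Y Z p
  have hfd : MDifferentiableAt (𝓡 n) 𝓘(ℝ, ℝ) f p := (hf p).mdifferentiableAt (by simp)
  have hE' : HasDerivAt (fun t : ℝ ↦ Real.exp (2 * t)) (2 * Real.exp (2 * f p)) (f p) := by
    simpa [mul_comm] using ((hasDerivAt_id (f p)).const_mul 2).exp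
  have hEm : MDifferentiableAt 𝓘(ℝ, ℝ) 𝓘(ℝ, ℝ) (fun t : ℝ ↦ Real.exp (2 * t)) (f p) :=
    hE'.differentiableAt.mdifferentiableAt
  have hexp : mvfderiv (𝓡 n) (fun q ↦ Real.exp (2 * f q)) p (X p) =
      2 * Real.exp (2 * f p) * mvfderiv (𝓡 n) f p (X p) := by
    refine (mvfderiv_comp_apply p hEm hfd (X p)).trans ?_
    rw [mvfderiv, mfderiv_eq_fderiv, hE'.hasFDerivAt.fderiv]
    exact mul_comm _ _
  have hE : MDifferentiableAt (𝓡 n) 𝓘(ℝ, ℝ) (fun q ↦ Real.exp (2 * f q)) p :=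
    MDifferentiableAt.comp (g := fun t : ℝ ↦ Real.exp (2 * t)) p hEm hfd
  have hmul := congrArg (fun L ↦ L (X p)) (mvfderiv_fun_mul hE (g.mdifferentiableAt_inner Y Z p))
  simp only [add_apply, smul_apply, smul_eq_mul, hexp] at hmul
  change mvfderiv (𝓡 n) (fun q ↦ Real.exp (2 * f q) * g.inner q (Y q) (Z q)) p (X p)
    - Real.exp (2 * f p) * g.inner p (D Y p (X p)) (Z p)
    - Real.exp (2 * f p) * g.inner p (Y p) (D Z p (X p)) = 0
  rw [covDerivMetric] at h
  linear_combination hmul + Real.exp (2 * f p) * h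

end Weyl

theorem theorem1p5 (n : ℕ) (hn : 3 ≤ n) :
    (∀ (V : Type*) [AddCommGroup V] [Module ℝ V] [FiniteDimensional ℝ V],
      Module.finrank ℝ V = n →
      ∀ (h : LinearMap.BilinForm ℝ V) (_hsymm : h.IsSymm) (hnd : h.Nondegenerate)
        (A : V →ₗ[ℝ] V →ₗ[ℝ] V →ₗ[ℝ] V →ₗ[ℝ] ℝ),
        IsWeylCurvature h hnd A →
        (BianchiIdentity (conjugateCurvature (A · · · ·)) ↔ IsAlgebraicCurvature (A · · · ·))) ∧
    (∀ (N : Type*) [TopologicalSpace N] [T2Space N]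
      [ChartedSpace (EuclideanSpace ℝ (Fin n)) N] [IsManifold (𝓡 n) ∞ N]
      (g : PseudoRiemannianMetric n N) (D : Connection n N),
      IsWeylManifold g D →
      Subsingleton (DeRhamH1 n N) →
      IsGeneralizedCurvature (conjugateCurvature (curvatureTensor g D)) →
      ∃ (f : N → ℝ) (hf : ContMDiff (𝓡 n) 𝓘(ℝ, ℝ) ∞ f), IsLeviCivita (g.conformal f hf) D) := by
  refine ⟨fun V _ _ _ hV h _ hnd A hA ↦ hA.bianchiIdentity_conjugate_iff (hn.trans_eq hV.symm),
    fun N _ _ _ _ g D hW hH hR ↦ ?_⟩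
  obtain ⟨hD, hT, φ, hφ⟩ := hW
  have hclosed : φ ∈ closedOneForms n N := oneFormDeriv_eq_zero hn hD hT hφ hR.2
  have hexact : φ ∈ exactOneForms n N := by
    rw [Submodule.Quotient.subsingleton_iff] at hH
    have : (⟨φ, hclosed⟩ : closedOneForms n N) ∈
        (exactOneForms n N).submoduleOf (closedOneForms n N) := hH ▸ Submodule.mem_top
    exact this
  obtain ⟨f, hf, hdf⟩ := hexact
  exact ⟨f, hf, isLeviCivita_conformal hD hT hf fun X Y Z p ↦ by rw [hφ, hdf]⟩
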